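/- **Setting.** Let $V$ be a finite set, $X=(X_i)_{i\in V}$ and $E=(E_i)_{i\in V}$ families of real, square-integrable processes indexed by $\mathbb Z$ on a probability space, each family jointly wide-sense stationary with absolutely summable correlations $R^X_{ij}(k)=\mathbb E[X_i(k)X_j(0)]$, resp. $R^E_{ij}(k)=\mathbb E[E_i(k)E_j(0)]$. Let $H(l)\in\mathbb R^{V\times V}$, $l\in\mathbb Z$, be entrywise absolutely summable, and write $\widehat H(\omega)=\sum_l H(l)e^{-\mathrm i\omega l}$, $\Phi_{X,ij}(\omega)=\sum_k R^X_{ij}(k)e^{-\mathrm i\omega k}$, and likewise $\Phi_E$. They form a *linear dynamic influence model* (LDIM) if $$X(t)=\sum_{l\in\mathbb Z}H(l)X(t-l)+E(t)\quad(t\in\mathbb Z,\ \text{convergence in } L^2),$$ and, for every $\omega$: $\widehat H_{ii}(\omega)=0$ for all $i$; every principal submatrix of $I-\widehat H(\omega)$ is invertible; $\Phi_E(\omega)$ is diagonal and positive definite; and the entries of $(I-\widehat H(\omega))^{-1}$ are analytic functions of $\omega$. Its graph $G$ has vertex set $V$ and an edge $u\to v$ iff $\widehat H_{vu}$ is not identically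 zero; directed cycles are allowed. A *path* in a directed graph is a finite sequence of consecutive edges, each traversed along or against its direction (the edges used are part of the path; vertices may repeat). An interior vertex of it is a *collider* if both adjacent edges of the path point into it. A *descendant* of $v$ is a vertex reached from $v$ by a directed path with at least one edge. A set $Z$ *d-separates* two vertices $a\neq b$ not in $Z$ if every path from $a$ to $b$ contains a non-collider in $Z$, or a collider $w$ such that neither $w$ nor any descendant of $w$ lies in $Z$. For $i\in V$ and $C\subseteq V$ the *Wiener filter* of the projection of $X_i$ onto $X_C$ is the row vector $W_{i\cdot C}(\omega)=\Phi_{X,iC}(\omega)\,\Phi_{X,CC}(\omega)^{-1}$. **Theorem (single-door criterion).** Given an LDIM with graph $G$, let $U\ne Y$ be vertices, $Z\subseteq V\setminus\{U,Y\}$, and let $\alpha(\omega)=\widehat H_{YU}(\omega)$ be the weight of the link $U\to Y$. Suppose that * (C1) no descendant of $Y$ in $G$ lies in $Z$; * (C2) $Z$ d-separates $U$ and $Y$ in the graph obtained from $G$ by deleting the edge $U\to Y$; * (C3) no directed cycle of $G$ passes through $Y$. Then, for every $\omega$, the matrix $\Phi_{X,CC}(\omega)$ with $C=\{U\}\cup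 Z$ is invertible and the coefficient of $U$ in the projection of $Y$ onto $[U,Z]$ is $$W_{Y\cdot C}[U](\omega)=\alpha(\omega).$$ Moreover, whenever absolutely summable real filters $(w_c)_{c\in C}$ realize the minimum mean square estimate, i.e. for every $t$ the series $\sum_{l\in\mathbb Z}\sum_{c\in C}w_c(l)X_c(t-l)$ converges in $L^2$ to the orthogonal projection of $X_Y(t)$ onto the closed linear span of $\{X_c(s):c\in C,\ s\in\mathbb Z\}$, one has $\sum_l w_U(l)e^{-\mathrm i\omega l}=\alpha(\omega)$ for every $\omega$. -/

import Mathlib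

open MeasureTheory
open scoped ComplexOrder

/-! ### Directed graphs and d-separation -/

section Graphs

variable {V : Type*}

/-- `b` is a descendant of `a`: there is a directed path with at least one edge from `a` to `b`. -/
def Digraph.IsDescendant (G : Digraph V) (a b : V) : Prop :=
  Relation.TransGen G.Adj a b

/-- The graph obtained from `G` by deleting the edge `u → y`. -/
def Digraph.deleteEdge (G : Digraph V) (u y : V) : Digraph V where
  Adj a b := G.Adj a b ∧ ¬ (a = u ∧ b = y)

/-- A path with `m` edges: consecutive vertices `ℓ k`, `ℓ (k + 1)` (`k < m`) are joined by an edge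
of `G`, traversed along its arrow (`d k = true`, `ℓ k → ℓ (k + 1)`) or against it
(`d k = false`, `ℓ k ← ℓ (k + 1)`). The choice of the edge is part of the path, which matters when
both `a → b` and `b → a` are edges. -/
def Digraph.IsPath (G : Digraph V) (m : ℕ) (ℓ : ℕ → V) (d : ℕ → Bool) : Prop :=
  ∀ k < m, if d k = true then G.Adj (ℓ k) (ℓ (k + 1)) else G.Adj (ℓ (k + 1)) (ℓ k)

/-- Position `k` of a path with `m` edges and directions `d` is a collider:
`ℓ (k - 1) → ℓ k ← ℓ (k + 1)`. -/
def IsCollider (m : ℕ) (d : ℕ → Bool) (k : ℕ) : Prop :=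
  0 < k ∧ k < m ∧ d (k - 1) = true ∧ d k = false

/-- A path is blocked by `Z` if it has a non-collider in `Z`, or a collider such that neither it nor
any of its descendants is in `Z`. -/
def Digraph.IsBlocked (G : Digraph V) (Z : Set V) (m : ℕ) (ℓ : ℕ → V) (d : ℕ → Bool) : Prop :=
  (∃ k ≤ m, ¬ IsCollider m d k ∧ ℓ k ∈ Z) ∨
    ∃ k, IsCollider m d k ∧ ℓ k ∉ Z ∧ ∀ z ∈ Z, ¬ G.IsDescendant (ℓ k) z

/-- `Z` d-separates `A` and `B` in `G` (meant for pairwise disjoint `A`, `B`, `Z`). -/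
def Digraph.DSep (G : Digraph V) (A Z B : Set V) : Prop :=
  ∀ (m : ℕ) (ℓ : ℕ → V) (d : ℕ → Bool),
    ℓ 0 ∈ A → ℓ m ∈ B → G.IsPath m ℓ d → G.IsBlocked Z m ℓ d

end Graphs

/-! ### Wide-sense stationary processes, spectral densities, Wiener filters -/

noncomputable section Processes

/-- Discrete-time Fourier transform `∑ₖ x(k) e^{-iωk}`. -/
def dtft (x : ℤ → ℝ) (ω : ℝ) : ℂ :=
  ∑' k : ℤ, (x k : ℂ) * Complex.exp (-(Complex.I * ω * k))

variable {V Θ : Type*} [MeasurableSpace Θ] {P : Measure Θ}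

/-- Cross-correlation `R_{ij}(k) = 𝔼[X_i(k) X_j(0)]`. -/
def crossCorr (X : V → ℤ → Lp ℝ 2 P) (i j : V) (k : ℤ) : ℝ :=
  ∫ θ, X i k θ * X j 0 θ ∂P

/-- The processes `X i` (real, square integrable) are jointly wide-sense stationary. -/
structure JointlyWSS (X : V → ℤ → Lp ℝ 2 P) : Prop where
  mean_const : ∀ i t, ∫ θ, X i t θ ∂P = ∫ θ, X i 0 θ ∂P
  corr_shift : ∀ i j k t, ∫ θ, X i (t + k) θ * X j t θ ∂P = crossCorr X i j k

/-- Power spectral density matrix `Φ_{ij}(ω) = ∑ₖ R_{ij}(k) e^{-iωk}`. -/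
def psd (X : V → ℤ → Lp ℝ 2 P) (ω : ℝ) : Matrix V V ℂ :=
  Matrix.of fun i j => dtft (crossCorr X i j) ω

/-- Spectral density matrix `Φ_{CC}(ω)` of the processes in `C`. -/
def psdOn (X : V → ℤ → Lp ℝ 2 P) (C : Finset V) (ω : ℝ) : Matrix C C ℂ :=
  (psd X ω).submatrix Subtype.val Subtype.val

/-- Multivariate Wiener filter `W_{i·C}(ω) = Φ_{iC}(ω) Φ_{CC}(ω)⁻¹` (a row vector indexed by `C`)
of the projection of `X i` onto the processes in `C`. -/
def wienerFilter [DecidableEq V] (X : V → ℤ → Lp ℝ 2 P) (i : V) (C : Finset V) (ω : ℝ) : C → ℂ :=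
  Matrix.vecMul (fun c : C => psd X ω i c) (psdOn X C ω)⁻¹

/-- The closed subspace of `L²` generated by all the variables `X c t`, `c ∈ C`, `t ∈ ℤ`. -/
def processSpan (X : V → ℤ → Lp ℝ 2 P) (C : Finset V) : Submodule ℝ (Lp ℝ 2 P) :=
  (Submodule.span ℝ {x | ∃ c ∈ C, ∃ t : ℤ, x = X c t}).topologicalClosure

/-- The absolutely summable impulse responses `w c`, `c ∈ C`, realize the minimum mean square
estimate of `X i` from the processes in `C`: for every time `t`, the orthogonal projection `p` of
`X i t` onto the closed span of these processes is `∑_{l} ∑_{c ∈ C} w_c(l) X_c(t - l)`. -/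
structure RealizesProjection (X : V → ℤ → Lp ℝ 2 P) (i : V) (C : Finset V)
    (w : C → ℤ → ℝ) : Prop where
  summable : ∀ c, Summable fun l => |w c l|
  is_projection : ∀ t : ℤ, ∃ p ∈ processSpan X C,
    X i t - p ∈ (processSpan X C)ᗮ ∧ HasSum (fun l : ℤ => ∑ c : C, w c l • X c (t - l)) p

/-! ### Linear dynamic influence models -/

/-- The transfer function `Ĥ(ω) = ∑ₗ H(l) e^{-iωl}`. -/
def transferFn (H : ℤ → Matrix V V ℝ) (ω : ℝ) : Matrix V V ℂ :=
  Matrix.of fun i j => dtft (fun l => H l i j) ω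

/-- The graph of the model: `u → v` iff `Ĥ_{vu}` is not identically zero. -/
def ldimGraph (H : ℤ → Matrix V V ℝ) : Digraph V where
  Adj u v := ∃ ω : ℝ, transferFn H ω v u ≠ 0

/-- The processes `X` are governed by the linear dynamic influence model
`X(t) = ∑ₗ H(l) X(t - l) + E(t)`, that is `X̂ = Ĥ X̂ + Ê`. All frequency functions are
`2π`-periodic, so `ω ∈ ℝ` stands for `ω ∈ [0, 2π]`. -/
structure IsLDIM [Fintype V] [DecidableEq V] (H : ℤ → Matrix V V ℝ)
    (X E : V → ℤ → Lp ℝ 2 P) : Prop where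
  /-- the impulse responses are absolutely summable -/
  summable_H : ∀ i j, Summable fun l => |H l i j|
  /-- the observed processes are jointly stationary and have a spectral density -/
  wss_X : JointlyWSS X
  summable_X : ∀ i j, Summable fun k => |crossCorr X i j k|
  /-- the noises are jointly stationary and have a spectral density -/
  wss_E : JointlyWSS E
  summable_E : ∀ i j, Summable fun k => |crossCorr E i j k|
  /-- the model equation, with convergence in mean square -/
  model : ∀ i t, HasSum (fun l : ℤ => ∑ j, H l i j • X j (t - l)) (X i t - E i t)
  diag_zero : ∀ i ω, transferFn H ω i i = 0
  /-- well-posedness: every principal submatrix of `I - Ĥ(ω)` is invertible and the entries of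
  `(I - Ĥ(ω))⁻¹` are analytic -/
  isUnit_principal : ∀ (S : Finset V) (ω : ℝ), IsUnit
    ((1 - transferFn H ω).submatrix (Subtype.val : S → V) (Subtype.val : S → V))
  analytic_inv : ∀ i j, AnalyticOnNhd ℝ (fun ω : ℝ => (1 - transferFn H ω)⁻¹ i j) Set.univ
  /-- the noise spectrum is positive definite and diagonal at every frequency -/
  posDef_E : ∀ ω, (psd E ω).PosDef
  isDiag_E : ∀ ω, (psd E ω).IsDiag

end Processes

/-! Fix a frequency and put `A = I - Ĥ`, `T = A⁻¹`. The model gives `Φ_X = T Φ_E Tᴴ`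
(`IsLDIM.psd_eq`), which is positive definite, so the normal equations on `[U, Z]` have one
solution. It suffices to find `β` such that `Y - αU - ∑ β_z z` is uncorrelated with `U` and `Z`.

Cancel the entry `(Y, U)` of `A` and make the rows of the descendants of `Y` trivial. By
`Matrix.surgery_mul_inverse` the new covariance has `Y - αU` in place of `Y` and is unchanged among
`U` and `Z`, which are not descendants of `Y`. Its graph lies in `G` without `U → Y`, where `Z`
separates `U` from `Y`.

Take `β` as the regression of `Y - αU` on `Z`. That the residual is uncorrelated with `U` is
`Matrix.vecMul_covariance_eq_zero_of_separated`, an energy argument that tolerates cycles: the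
covariances, restricted to the vertices reachable from `U` by active walks, have weighted energy
zero. The graph input is `Digraph.activeWalk_transfer`: reachability is shared by all the relevant
vertices outside `Z` in one row of the matrix. -/

/-! ### Active walks and d-separation. -/

namespace Digraph

variable {V : Type*} {G : Digraph V} {Z : Set V} {u : V}

/-- `G.ActiveWalk Z u v b`: some walk from `u` to `v` is not blocked by `Z` at any vertex before
its end, and its last edge points into `v` iff `b = true` (the empty walk has `b = false`). -/
inductive ActiveWalk (G : Digraph V) (Z : Set V) (u : V) : V → Bool → Prop
  | refl : ActiveWalk G Z u u false
  | backward {v w : V} : ActiveWalk G Z u v false → v ∉ Z → G.Adj w v → ActiveWalk G Z u w false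
  | forward {v w : V} {b : Bool} : ActiveWalk G Z u v b → v ∉ Z → G.Adj v w →
      ActiveWalk G Z u w true
  | collider {v w : V} : ActiveWalk G Z u v true → (v ∈ Z ∨ ∃ z ∈ Z, G.IsDescendant v z) →
      G.Adj w v → ActiveWalk G Z u w false

/-- A path from `u` to `v` with `m` edges that is open before its end, with final direction `b`. -/
def IsOpenPath (G : Digraph V) (Z : Set V) (u v : V) (b : Bool) (m : ℕ) (ℓ : ℕ → V)
    (d : ℕ → Bool) : Prop :=
  ℓ 0 = u ∧ ℓ m = v ∧ G.IsPath m ℓ d ∧ (m = 0 ∧ b = false ∨ 0 < m ∧ d (m - 1) = b) ∧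
    ∀ k < m, (¬ IsCollider m d k → ℓ k ∉ Z) ∧
      (IsCollider m d k → ℓ k ∈ Z ∨ ∃ z ∈ Z, G.IsDescendant (ℓ k) z)

/-- Being a collider depends only on the two adjacent directions, so a new edge settles the status
of the old endpoint `v` and of no other earlier vertex. -/
theorem IsOpenPath.extend {v w : V} {b c : Bool} {m : ℕ} {ℓ : ℕ → V} {d : ℕ → Bool}
    (h : G.IsOpenPath Z u v b m ℓ d)
    (hadj : if c = true then G.Adj v w else G.Adj w v)
    (hnon : ¬ (b = true ∧ c = false) → v ∉ Z)
    (hcol : b = true ∧ c = false → v ∈ Z ∨ ∃ z ∈ Z, G.IsDescendant v z) :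
    G.IsOpenPath Z u w c (m + 1) (Function.update ℓ (m + 1) w) (Function.update d m c) := by
  obtain ⟨h0, hm, hp, hb, ho⟩ := h
  have hℓ : ∀ k ≤ m, Function.update ℓ (m + 1) w k = ℓ k := fun k hk =>
    Function.update_of_ne (by omega) _ _
  have hd : ∀ k < m, Function.update d m c k = d k := fun k hk =>
    Function.update_of_ne (by omega) _ _
  have hlt : ∀ k < m, (IsCollider (m + 1) (Function.update d m c) k ↔ IsCollider m d k) := by
    intro k hk
    unfold IsCollider
    rw [hd k hk, hd (k - 1) (by omega)]
    constructor
    · rintro ⟨a1, -, a3⟩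
      exact ⟨a1, hk, a3⟩
    · rintro ⟨a1, -, a3⟩
      exact ⟨a1, by omega, a3⟩
  have hend : IsCollider (m + 1) (Function.update d m c) m ↔ (b = true ∧ c = false) := by
    unfold IsCollider
    rcases hb with ⟨rfl, rfl⟩ | ⟨hpos, hb⟩
    · simp
    · rw [hd (m - 1) (by omega), hb, Function.update_self]
      constructor
      · rintro ⟨-, -, a⟩
        exact a
      · intro a
        exact ⟨hpos, by omega, a⟩
  refine ⟨by rw [hℓ 0 (Nat.zero_le _), h0], Function.update_self .., ?_, ?_, ?_⟩
  · intro k hk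
    rcases Nat.lt_succ_iff_lt_or_eq.1 hk with hk | rfl
    · rw [hd k hk, hℓ k hk.le, hℓ (k + 1) hk]
      exact hp k hk
    · rw [Function.update_self, Function.update_self, hℓ k le_rfl, hm]
      exact hadj
  · exact Or.inr ⟨Nat.succ_pos _, by simp⟩
  · intro k hk
    rcases Nat.lt_succ_iff_lt_or_eq.1 hk with hk | rfl
    · rw [hlt k hk, hℓ k hk.le]
      exact ho k hk
    · rw [hend, hℓ k le_rfl, hm]
      exact ⟨hnon, hcol⟩

theorem ActiveWalk.exists_isOpenPath {v : V} {b : Bool} (h : G.ActiveWalk Z u v b) :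
    ∃ m ℓ d, G.IsOpenPath Z u v b m ℓ d := by
  induction h with
  | refl => exact ⟨0, fun _ => u, fun _ => false, rfl, rfl, by simp [IsPath], by simp, by simp⟩
  | backward _ hv hadj ih =>
    obtain ⟨m, ℓ, d, h⟩ := ih
    exact ⟨_, _, _, h.extend (c := false) (by simpa using hadj) (fun _ => hv) (by simp)⟩
  | forward _ hv hadj ih =>
    obtain ⟨m, ℓ, d, h⟩ := ih
    exact ⟨_, _, _, h.extend (c := true) (by simpa using hadj) (fun _ => hv) (by simp)⟩
  | collider _ hv hadj ih =>
    obtain ⟨m, ℓ, d, h⟩ := ih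
    exact ⟨_, _, _, h.extend (c := false) (by simpa using hadj) (by simp) (fun _ => hv)⟩

theorem DSep.not_activeWalk {y : V} (h : G.DSep {u} Z {y}) (hy : y ∉ Z) (b : Bool) :
    ¬ G.ActiveWalk Z u y b := by
  intro hw
  obtain ⟨m, ℓ, d, h0, hm, hp, -, ho⟩ := hw.exists_isOpenPath
  rcases h m ℓ d h0 hm hp with ⟨k, hk, hc, hz⟩ | ⟨k, hc, hz, hdes⟩
  · rcases hk.lt_or_eq with hk | rfl
    · exact (ho k hk).1 hc hz
    · exact hy (hm ▸ hz)
  · rcases (ho k hc.2.1).2 hc with h1 | ⟨z, hz1, hz2⟩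
    · exact hz h1
    · exact hdes z hz1 hz2

/-- `a` is in `T` or has a descendant in `T`. -/
def IsAncestorOf (G : Digraph V) (T : Set V) (a : V) : Prop :=
  ∃ t ∈ T, Relation.ReflTransGen G.Adj a t

theorem IsAncestorOf.of_adj {T : Set V} {a b : V} (hab : G.Adj a b) (h : G.IsAncestorOf T b) :
    G.IsAncestorOf T a := by
  obtain ⟨t, ht, hbt⟩ := h
  exact ⟨t, ht, hbt.head hab⟩

theorem IsAncestorOf.mem_or {T : Set V} {a : V} (h : G.IsAncestorOf T a) :
    a ∈ T ∨ ∃ z ∈ T, G.IsDescendant a z := by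
  obtain ⟨t, ht, hat⟩ := h
  rcases Relation.reflTransGen_iff_eq_or_transGen.1 hat with rfl | hat
  · exact Or.inl ht
  · exact Or.inr ⟨t, ht, hat⟩

/-- Along a directed path to `u` that avoids `Z`, one may walk backwards. -/
theorem activeWalk_of_reflTransGen {c : V} (h : Relation.ReflTransGen G.Adj c u)
    (hc : ∀ w, Relation.ReflTransGen G.Adj c w → w ∉ Z) : G.ActiveWalk Z u c false := by
  induction h using Relation.ReflTransGen.head_induction_on with
  | refl => exact .refl
  | head hab _ ih =>
    exact (ih fun w hw => hc w (hw.head hab)).backward (hc _ (.single hab)) hab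

theorem ActiveWalk.of_reflTransGen {c y : V} {b : Bool} (hw : G.ActiveWalk Z u c b)
    (h : Relation.ReflTransGen G.Adj c y)
    (hc : ∀ w, Relation.ReflTransGen G.Adj c w → w ∉ Z) : ∃ b', G.ActiveWalk Z u y b' := by
  induction h with
  | refl => exact ⟨b, hw⟩
  | tail hcx hxy ih =>
    obtain ⟨b', hb'⟩ := ih
    exact ⟨true, hb'.forward (hc _ hcx) hxy⟩

/-- If no active walk ends at `y`, an arrow-in walk at an ancestor `c` of `{u, y} ∪ Z` can be
continued against any edge into `c`. -/
theorem ActiveWalk.adj_of_isAncestorOf {y c w : V} {b : Bool}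
    (hy : ∀ b, ¬ G.ActiveWalk Z u y b) (hc : G.IsAncestorOf (insert u (insert y Z)) c)
    (hw : G.ActiveWalk Z u c b) (hcZ : c ∉ Z ∨ b = true) (hadj : G.Adj w c) :
    G.ActiveWalk Z u w false := by
  by_cases hZ : G.IsAncestorOf Z c
  · cases b with
    | true => exact hw.collider hZ.mem_or hadj
    | false => exact hw.backward (by simpa using hcZ) hadj
  · have hav : ∀ w, Relation.ReflTransGen G.Adj c w → w ∉ Z := fun w hcw hwZ => hZ ⟨w, hwZ, hcw⟩
    -- No vertex at or below `c` is in `Z`. If `c` leads to `u`, a fresh walk climbs from `u` to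
    -- `c`; if it leads to `y`, the given walk would run on to `y`.
    obtain ⟨t, rfl | rfl | ht, hct⟩ := hc
    · exact (activeWalk_of_reflTransGen hct hav).backward (hav c .refl) hadj
    · obtain ⟨b', hb'⟩ := hw.of_reflTransGen hct hav
      exact absurd hb' (hy b')
    · exact absurd ⟨t, ht, hct⟩ hZ

/-- Two ancestors of `{u, y} ∪ Z` that are equal to `c` or parents of `c` are either both
reached by active walks or both not. -/
theorem activeWalk_transfer {y c i j : V} (hy : ∀ b, ¬ G.ActiveWalk Z u y b)
    (hc : G.IsAncestorOf (insert u (insert y Z)) c) (hi : i ∉ Z)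
    (hic : i = c ∨ G.Adj i c) (hjc : j = c ∨ G.Adj j c) (h : ∃ b, G.ActiveWalk Z u i b) :
    ∃ b, G.ActiveWalk Z u j b := by
  obtain ⟨b, h⟩ := h
  rcases hic with rfl | hic
  · rcases hjc with rfl | hjc
    · exact ⟨b, h⟩
    · exact ⟨false, h.adj_of_isAncestorOf hy hc (Or.inl hi) hjc⟩
  -- The walk enters `c` along an arrow, so at `c` it can turn back to the parent `j` even if `c` is
  -- in `Z`.
  · have hM : G.ActiveWalk Z u c true := h.forward hi hic
    rcases hjc with rfl | hjc
    · exact ⟨true, hM⟩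
    · exact ⟨false, hM.adj_of_isAncestorOf hy hc (Or.inr rfl) hjc⟩

end Digraph

/-! ### Fourier transforms, normal equations and the spectral factorization. -/

section Spectral

open Matrix

theorem norm_dtft_exp (ω : ℝ) (k : ℤ) : ‖Complex.exp (-(Complex.I * ω * k))‖ = 1 := by
  have : -(Complex.I * ω * k) = ((-(ω * k) : ℝ) : ℂ) * Complex.I := by
    push_cast
    ring
  rw [this, Complex.norm_exp_ofReal_mul_I]

theorem summable_norm_dtft {x : ℤ → ℝ} (hx : Summable x) (ω : ℝ) :
    Summable fun k : ℤ => ‖(x k : ℂ) * Complex.exp (-(Complex.I * ω * k))‖ := by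
  simpa [norm_dtft_exp] using hx.abs

theorem hasSum_dtft {x : ℤ → ℝ} (hx : Summable x) (ω : ℝ) :
    HasSum (fun k : ℤ => (x k : ℂ) * Complex.exp (-(Complex.I * ω * k))) (dtft x ω) :=
  (summable_norm_dtft hx ω).of_norm.hasSum

theorem dtft_sub {x y : ℤ → ℝ} (hx : Summable x) (hy : Summable y) (ω : ℝ) :
    dtft (fun k => x k - y k) ω = dtft x ω - dtft y ω := by
  rw [← ((hasSum_dtft hx ω).sub (hasSum_dtft hy ω)).tsum_eq]
  refine tsum_congr fun k => ?_
  push_cast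
  ring

/-- Time reversal conjugates the Fourier transform of a real sequence. -/
theorem dtft_comp_neg (x : ℤ → ℝ) (ω : ℝ) : dtft (fun k => x (-k)) ω = star (dtft x ω) := by
  unfold dtft
  rw [← (Equiv.neg ℤ).tsum_eq, tsum_star]
  refine tsum_congr fun k => ?_
  simp [← Complex.exp_conj]

theorem hasSum_mul_prod_of_summable_norm {f g : ℤ → ℂ} {a b : ℂ} (hf : HasSum f a)
    (hg : HasSum g b) (hf' : Summable fun k => ‖f k‖) (hg' : Summable fun k => ‖g k‖) :
    HasSum (fun q : ℤ × ℤ => f q.1 * g q.2) (a * b) := by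
  rw [← hf.tsum_eq, ← hg.tsum_eq, tsum_mul_tsum_of_summable_norm hf' hg']
  exact (summable_mul_of_summable_norm hf' hg').hasSum

/-- Sums of convolutions of summable sequences and their Fourier transforms. -/
theorem hasSum_dtft_of_convolution {ι : Type*} [Fintype ι] {a r : ι → ℤ → ℝ} {g : ℤ → ℝ}
    (ha : ∀ j, Summable (a j)) (hr : ∀ j, Summable (r j))
    (hg : ∀ t, HasSum (fun l => ∑ j, a j l * r j (t - l)) (g t)) (ω : ℝ) :
    HasSum (fun t : ℤ => (g t : ℂ) * Complex.exp (-(Complex.I * ω * t)))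
      (∑ j, dtft (a j) ω * dtft (r j) ω) := by
  have hprod : HasSum (fun q : ℤ × ℤ => ∑ j,
      ((a j q.1 : ℂ) * Complex.exp (-(Complex.I * ω * q.1))) *
        ((r j q.2 : ℂ) * Complex.exp (-(Complex.I * ω * q.2))))
      (∑ j, dtft (a j) ω * dtft (r j) ω) := by
    refine hasSum_sum fun j _ => ?_
    have h := hasSum_mul_prod_of_summable_norm (hasSum_dtft (ha j) ω) (hasSum_dtft (hr j) ω)
      (summable_norm_dtft (ha j) ω) (summable_norm_dtft (hr j) ω)
    exact h
  -- The double series converges absolutely; summing it along the lines of constant total lag `t`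
  -- also yields the summability of `g`.
  let φ : ℤ × ℤ ≃ ℤ × ℤ :=
    { toFun := fun q => (q.2, q.1 - q.2)
      invFun := fun q => (q.1 + q.2, q.1)
      left_inv := fun q => by simp
      right_inv := fun q => by simp }
  refine ((φ.hasSum_iff).2 hprod).prod_fiberwise fun t => ?_
  have h := (Complex.hasSum_ofReal.2 (hg t)).mul_right (Complex.exp (-(Complex.I * ω * t)))
  refine h.congr_fun fun l => ?_
  simp only [φ, Function.comp_apply, Equiv.coe_fn_mk]
  push_cast
  rw [Finset.sum_mul]
  refine Finset.sum_congr rfl fun j _ => ?_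
  have he : Complex.exp (-(Complex.I * ω * t)) = Complex.exp (-(Complex.I * ω * l)) *
      Complex.exp (-(Complex.I * ω * (t - l))) := by
    rw [← Complex.exp_add]
    congr 1
    ring
  rw [he]
  ring

theorem summable_of_convolution {ι : Type*} [Fintype ι] {a r : ι → ℤ → ℝ} {g : ℤ → ℝ}
    (ha : ∀ j, Summable (a j)) (hr : ∀ j, Summable (r j))
    (hg : ∀ t, HasSum (fun l => ∑ j, a j l * r j (t - l)) (g t)) : Summable g := by
  have h := (hasSum_dtft_of_convolution ha hr hg 0).summable
  simp only [Complex.ofReal_zero, mul_zero, zero_mul, neg_zero, Complex.exp_zero, mul_one] at h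
  exact Complex.summable_ofReal.1 h

theorem HasSum.inner_filter {ι F : Type*} [Fintype ι] [NormedAddCommGroup F]
    [InnerProductSpace ℝ F] {a : ι → ℤ → ℝ} {X : ι → ℤ → F} {p : F} {t : ℤ}
    (h : HasSum (fun l => ∑ j, a j l • X j (t - l)) p) (q : F) :
    HasSum (fun l => ∑ j, a j l * inner ℝ (X j (t - l)) q) (inner ℝ p q) := by
  have := (innerSL ℝ q).hasSum h
  simpa [real_inner_comm, inner_sum, inner_smul_right] using this

variable {V Θ : Type*} [MeasurableSpace Θ] {P : Measure Θ}

theorem integral_mul_eq_inner (f g : Lp ℝ 2 P) : ∫ θ, f θ * g θ ∂P = inner ℝ f g := by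
  rw [L2.inner_def]
  simp [mul_comm]

theorem crossCorr_eq_inner (X : V → ℤ → Lp ℝ 2 P) (i j : V) (k : ℤ) :
    crossCorr X i j k = inner ℝ (X i k) (X j 0) :=
  integral_mul_eq_inner _ _

theorem JointlyWSS.inner_eq {X : V → ℤ → Lp ℝ 2 P} (h : JointlyWSS X) (i j : V) (s t : ℤ) :
    inner ℝ (X i s) (X j t) = crossCorr X i j (s - t) := by
  rw [← h.corr_shift i j (s - t) t, integral_mul_eq_inner]
  simp

/-- Normal equations: the Fourier transforms of summable filters that realize the projection of
`X i` onto the processes in `C` solve `ŵ Φ_CC = Φ_iC`. -/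
theorem RealizesProjection.vecMul_psdOn [DecidableEq V] {X : V → ℤ → Lp ℝ 2 P}
    (hX : ∀ i j, Summable fun k => |crossCorr X i j k|) {i : V} {C : Finset V} {w : C → ℤ → ℝ}
    (h : RealizesProjection X i C w) (ω : ℝ) :
    (fun c => dtft (w c) ω) ᵥ* psdOn X C ω = fun c : C => psd X ω i c := by
  funext c
  refine ((hasSum_dtft_of_convolution (g := crossCorr X i c) (r := fun j : C => crossCorr X j c)
    (fun j => (h.summable j).of_abs) (fun j => (hX j c).of_abs) (fun t => ?_) ω).unique
    (hasSum_dtft (hX i c).of_abs ω))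
  obtain ⟨p, -, hperp, hp⟩ := h.is_projection t
  have hc : X c 0 ∈ processSpan X C :=
    Submodule.le_topologicalClosure _ (Submodule.subset_span ⟨c, c.2, 0, rfl⟩)
  have h0 := (Submodule.mem_orthogonal' _ _).1 hperp _ hc
  rw [inner_sub_left, sub_eq_zero] at h0
  rw [crossCorr_eq_inner, h0]
  simpa only [crossCorr_eq_inner] using
    HasSum.inner_filter (X := fun (j : C) t => X j t) hp (X c 0)

namespace IsLDIM

variable [Fintype V] [DecidableEq V] {H : ℤ → Matrix V V ℝ} {X E : V → ℤ → Lp ℝ 2 P}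

theorem hasSum_inner (hL : IsLDIM H X E) (i : V) (t : ℤ) (q : Lp ℝ 2 P) :
    HasSum (fun l => ∑ j, H l i j * inner ℝ (X j (t - l)) q)
      (inner ℝ (X i t) q - inner ℝ (E i t) q) := by
  rw [← inner_sub_left]
  exact HasSum.inner_filter (a := fun j l => H l i j) (hL.model i t) q

theorem summable_inner_noise (hL : IsLDIM H X E) {q : Lp ℝ 2 P}
    (hq : ∀ j, Summable fun s => inner ℝ (X j s) q) (i : V) :
    Summable fun t => inner ℝ (E i t) q := by
  have h := summable_of_convolution (fun j => (hL.summable_H i j).of_abs) hq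
    (fun t => hL.hasSum_inner i t q)
  simpa using (hq i).sub h

theorem dtft_inner_noise (hL : IsLDIM H X E) {q : Lp ℝ 2 P}
    (hq : ∀ j, Summable fun s => inner ℝ (X j s) q) (i : V) (ω : ℝ) :
    dtft (fun t => inner ℝ (E i t) q) ω =
      ∑ j, (1 - transferFn H ω) i j * dtft (fun s => inner ℝ (X j s) q) ω := by
  have h := (hasSum_dtft_of_convolution (fun j => (hL.summable_H i j).of_abs) hq
    (fun t => hL.hasSum_inner i t q) ω).tsum_eq
  have h' := dtft_sub (hq i) (hL.summable_inner_noise hq i) ω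
  rw [dtft, h] at h'
  have : ∑ j, (1 - transferFn H ω) i j * dtft (fun s => inner ℝ (X j s) q) ω =
      dtft (fun s => inner ℝ (X i s) q) ω -
        ∑ j, dtft (fun l => H l i j) ω * dtft (fun s => inner ℝ (X j s) q) ω := by
    simp [Matrix.one_apply, sub_mul, Finset.sum_sub_distrib, transferFn]
  rw [this, h']
  ring

/-- Joint stationarity of `X` with `E` is not assumed; it follows because the model expresses `E`
through `X`. -/
theorem inner_noise_shift (hL : IsLDIM H X E) (i m : V) (s : ℤ) :
    inner ℝ (X m s) (E i 0) = inner ℝ (E i (-s)) (X m 0) := by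
  have h1 := hL.hasSum_inner i 0 (X m s)
  have h2 := hL.hasSum_inner i (-s) (X m 0)
  simp only [hL.wss_X.inner_eq] at h1 h2
  have h3 : ∀ l : ℤ, 0 - l - s = -s - l - 0 := fun l => by ring
  simp only [h3] at h1
  have := h1.unique h2
  rw [zero_sub, sub_zero] at this
  rw [real_inner_comm]
  linarith

/-- The model equation is used once in each slot of the noise correlation, with a time reversal in
between that conjugates. This form needs no prior proof that `psd X ω` is Hermitian. -/
theorem psd_noise (hL : IsLDIM H X E) (ω : ℝ) :
    psd E ω = (1 - transferFn H ω) * ((1 - transferFn H ω) * psd X ω)ᴴ := by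
  have hX : ∀ m j, Summable fun s => inner ℝ (X j s) (X m 0) := fun m j =>
    (hL.summable_X j m).of_abs.congr fun k => crossCorr_eq_inner X j m k
  have hXE : ∀ i m, (fun s => inner ℝ (X m s) (E i 0)) =
      fun s => (fun t => inner ℝ (E i t) (X m 0)) (-s) :=
    fun i m => funext fun s => hL.inner_noise_shift i m s
  have hE : ∀ i m, Summable fun s => inner ℝ (X m s) (E i 0) := fun i m => by
    rw [hXE]
    exact (Equiv.neg ℤ).summable_iff.2 (hL.summable_inner_noise (hX m) i)
  ext j i
  have h : psd E ω j i = dtft (fun t => inner ℝ (E j t) (E i 0)) ω := by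
    simp only [psd, of_apply]
    exact congrArg (dtft · ω) (funext fun k => crossCorr_eq_inner E j i k)
  rw [h, hL.dtft_inner_noise (hE i), Matrix.mul_apply]
  refine Finset.sum_congr rfl fun m _ => ?_
  congr 1
  rw [hXE, dtft_comp_neg fun t => inner ℝ (E i t) (X m 0), hL.dtft_inner_noise (hX m), conjTranspose_apply, Matrix.mul_apply]
  simp only [psd, of_apply]
  congr 1
  refine Finset.sum_congr rfl fun n _ => ?_
  congr 1
  exact congrArg (dtft · ω) (funext fun k => (crossCorr_eq_inner X n m k).symm)

theorem isUnit_one_sub (hL : IsLDIM H X E) (ω : ℝ) : IsUnit (1 - transferFn H ω) := by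
  have h := hL.isUnit_principal Finset.univ ω
  rw [Matrix.isUnit_iff_isUnit_det] at h ⊢
  have hdet := Matrix.det_submatrix_equiv_self (Equiv.subtypeUnivEquiv (p := (· ∈ Finset.univ))
    (fun v : V => Finset.mem_univ v)) (1 - transferFn H ω)
  rw [← hdet]
  exact h

theorem psd_eq (hL : IsLDIM H X E) (ω : ℝ) :
    psd X ω = (1 - transferFn H ω)⁻¹ * psd E ω * ((1 - transferFn H ω)⁻¹)ᴴ := by
  have hu : IsUnit (1 - transferFn H ω).det :=
    (Matrix.isUnit_iff_isUnit_det _).1 (hL.isUnit_one_sub ω)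
  have hinv : ((1 - transferFn H ω) * psd X ω)ᴴ = (1 - transferFn H ω)⁻¹ * psd E ω := by
    rw [hL.psd_noise, ← Matrix.mul_assoc, Matrix.nonsing_inv_mul _ hu, Matrix.one_mul]
  have h2 := congrArg Matrix.conjTranspose hinv
  rw [conjTranspose_conjTranspose, conjTranspose_mul, (hL.posDef_E ω).1.eq] at h2
  rw [Matrix.mul_assoc, ← h2, ← Matrix.mul_assoc, Matrix.nonsing_inv_mul _ hu, Matrix.one_mul]

theorem posDef_psd (hL : IsLDIM H X E) (ω : ℝ) : (psd X ω).PosDef := by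
  rw [hL.psd_eq]
  refine (hL.posDef_E ω).mul_mul_conjTranspose_same ?_
  refine Matrix.vecMul_injective_of_isUnit ?_
  exact Matrix.isUnit_nonsing_inv_iff.2 (hL.isUnit_one_sub ω)

theorem isUnit_psdOn (hL : IsLDIM H X E) (C : Finset V) (ω : ℝ) : IsUnit (psdOn X C ω) :=
  ((hL.posDef_psd ω).submatrix Subtype.val_injective).isUnit

end IsLDIM

end Spectral

/-! ### Separation and surgery for covariances `T D Tᴴ`. -/

section LinearAlgebra

open Matrix

variable {V : Type*} [Fintype V] [DecidableEq V]

/-- The inverse of a matrix that does not leave the index set `B` does not leave it either. -/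
theorem Matrix.inverse_apply_eq_zero_of_closed {A T : Matrix V V ℂ} (hAT : A * T = 1) (B : Set V)
    (hB : ∀ c ∈ B, ∀ i ∉ B, A c i = 0) : ∀ c ∈ B, ∀ i ∉ B, T c i = 0 := by
  classical
  have hinv : Invertible A := _root_.invertibleOfRightInverse A T hAT
  have hT : T = A⁻¹ := (Matrix.inv_eq_right_inv hAT).symm
  -- With two levels, closedness of `B` is block triangularity, which passes to the inverse.
  let b : V → ℕ := fun i => if i ∈ B then 1 else 0
  have hbt : A.BlockTriangular b := by
    intro i j hij
    by_cases hi : i ∈ B <;> by_cases hj : j ∈ B <;> simp [b, hi, hj] at hij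
    exact hB i hi j hj
  intro c hc i hi
  rw [hT]
  exact Matrix.blockTriangular_inv_of_blockTriangular hbt (by simp [b, hc, hi])

/-- Let `T = A⁻¹`, let `v` be a combination of variables with covariance `T D Tᴴ` and `x` its
covariances with the variables. If `v` lives on the parent-closed set `B` and avoids `S`, if `x`
vanishes on `Z`, and if no row of `A` in `B` meets both `S` and `B \ (Z ∪ S)`, then `x` vanishes
on `S`. -/
theorem Matrix.vecMul_covariance_eq_zero_of_separated {A T : Matrix V V ℂ} (hAT : A * T = 1)
    {δ : V → ℂ} (hδ : ∀ c, 0 < δ c) (v : V → ℂ) (B S Z : Set V)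
    (hB : ∀ c ∈ B, ∀ i ∉ B, A c i = 0) (hSB : S ⊆ B)
    (hvB : ∀ i ∉ B, v i = 0) (hvS : ∀ i ∈ S, v i = 0)
    (hxZ : ∀ z ∈ Z, (v ᵥ* (T * diagonal δ * Tᴴ)) z = 0)
    (hsep : ∀ c ∈ B, ∀ i ∈ S, ∀ j ∈ B, j ∉ Z → j ∉ S → A c i = 0 ∨ A c j = 0) :
    ∀ i ∈ S, (v ᵥ* (T * diagonal δ * Tᴴ)) i = 0 := by
  classical
  have hTB := Matrix.inverse_apply_eq_zero_of_closed hAT B hB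
  have hTA : T * A = 1 := mul_eq_one_comm.1 hAT
  set x := v ᵥ* (T * diagonal δ * Tᴴ) with hx
  set e := v ᵥ* T with he
  let y : V → ℂ := S.indicator x
  let w : V → ℂ := y ᵥ* Aᴴ
  have heB : ∀ c ∉ B, e c = 0 := by
    intro c hc
    refine Finset.sum_eq_zero fun i _ => ?_
    by_cases hi : i ∈ B
    · simp [hTB i hi c hc]
    · simp [hvB i hi]
  have hxA : ∀ c, (x ᵥ* Aᴴ) c = e c * δ c := by
    intro c
    have : x ᵥ* Aᴴ = e ᵥ* diagonal δ := by
      rw [hx, he, vecMul_vecMul, vecMul_vecMul, Matrix.mul_assoc, ← conjTranspose_mul, hAT,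
        conjTranspose_one, Matrix.mul_one]
    rw [this, vecMul_diagonal]
  -- Since `e = vT` and `w = y Aᴴ`, the sum is the pairing of `v` with `y`, whose supports are
  -- disjoint.
  have hdot : ∑ c, e c * star (w c) = 0 := by
    have h1 : star w = A *ᵥ star y := by
      simp only [w, star_vecMul, conjTranspose_conjTranspose]
    have h2 : e ⬝ᵥ star w = v ⬝ᵥ star y := by
      rw [h1, dotProduct_mulVec, he, vecMul_vecMul, hTA, vecMul_one]
    have h3 : v ⬝ᵥ star y = 0 := by
      refine Finset.sum_eq_zero fun i _ => ?_
      by_cases hi : i ∈ S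
      · simp [hvS i hi]
      · simp [y, hi]
    exact h2.trans h3
  -- If `w c ≠ 0`, row `c` meets `S`, so within `B` it meets only `Z ∪ S`. There `x` and `y`
  -- contribute equally, as `x` vanishes on `Z`; hence `e c * δ c = w c`.
  have hterm : ∀ c ∈ B, e c * δ c * star (w c) = w c * star (w c) := by
    intro c hc
    by_cases hw : w c = 0
    · simp [hw]
    obtain ⟨i, hi, hAi⟩ : ∃ i ∈ S, A c i ≠ 0 := by
      by_contra hcon
      push Not at hcon
      refine hw (Finset.sum_eq_zero fun i _ => ?_)
      by_cases hi : i ∈ S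
      · simp [hcon i hi]
      · simp [y, hi]
    congr 1
    rw [← hxA]
    refine Finset.sum_congr rfl fun j _ => ?_
    by_cases hjS : j ∈ S
    · simp [y, hjS]
    · simp only [y, Set.indicator_of_notMem hjS, zero_mul, conjTranspose_apply]
      by_cases hjZ : j ∈ Z
      · simp [hxZ j hjZ]
      by_cases hjB : j ∈ B
      · rcases hsep c hc i hi j hjB hjZ hjS with h | h
        · exact absurd h hAi
        · simp [h]
      · simp [hB c hc j hjB]
  have hterm' : ∀ c, e c * star (w c) = if c ∈ B then w c * star (w c) / δ c else 0 := by
    intro c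
    split_ifs with hc
    · rw [← hterm c hc]
      field_simp [(hδ c).ne']
    · simp [heB c hc]
  have hnn : ∀ c ∈ Finset.univ, (0 : ℂ) ≤ if c ∈ B then w c * star (w c) / δ c else 0 := by
    intro c _
    split_ifs
    · rw [div_eq_mul_inv]
      exact mul_nonneg (mul_star_self_nonneg _) (inv_nonneg.2 (hδ c).le)
    · exact le_rfl
  have hwB : ∀ c ∈ B, w c = 0 := by
    intro c hc
    simp only [hterm'] at hdot
    have := (Finset.sum_eq_zero_iff_of_nonneg hnn).1 hdot c (Finset.mem_univ c)
    simpa [hc, (hδ c).ne'] using this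
  intro i hi
  have hyw : y = w ᵥ* Tᴴ := by
    simp only [w]
    rw [vecMul_vecMul, ← conjTranspose_mul, hTA, conjTranspose_one, vecMul_one]
  have hyi : y i = 0 := by
    rw [hyw]
    refine Finset.sum_eq_zero fun c _ => ?_
    by_cases hc : c ∈ B
    · simp [hwB c hc]
    · simp [hTB i (hSB hi) c hc]
  simpa [y, hi] using hyi

/-- The inverse of the matrix obtained from `A` by making the rows in `D` trivial and adding `α`
to the entry `(y, u)`, where `D ∪ {y}` is not used by the rows outside of it nor by row `y`. -/
theorem Matrix.surgery_mul_inverse {A T : Matrix V V ℂ} (hAT : A * T = 1) (D : Set V) {u y : V}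
    [DecidablePred (· ∈ D)] (huy : u ≠ y) (huD : u ∉ D) (hyD : y ∉ D) (hyy : A y y = 1)
    (hyrow : ∀ j ∈ D, A y j = 0)
    (hrow : ∀ i, i ≠ y → i ∉ D → ∀ j, j = y ∨ j ∈ D → A i j = 0) (α : ℂ) :
    (Matrix.of fun i j => if i ∈ D then (1 : Matrix V V ℂ) i j
        else if i = y ∧ j = u then A i j + α else A i j) *
      (Matrix.of fun i j => if i ∈ D then (1 : Matrix V V ℂ) i j
        else if i = y then T i j - α * T u j else T i j) = 1 := by
  have hrowT : ∀ i c, ∑ j, A i j * T j c = (1 : Matrix V V ℂ) i c := fun i c => by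
    rw [← hAT, Matrix.mul_apply]
  ext i c
  rw [Matrix.mul_apply]
  simp only [Matrix.of_apply]
  by_cases hiD : i ∈ D
  · rw [Finset.sum_eq_single i (fun j _ hj => by simp [hiD, Matrix.one_apply_ne' hj])
      (fun h => absurd (Finset.mem_univ i) h)]
    simp [hiD]
  simp only [if_neg hiD]
  by_cases hiy : i = y
  · subst hiy
    -- In row `y` the two corrections `± α T u c` cancel: one comes from the new entry at `u`, the
    -- other from the changed row `y` of `T`, weighted by the diagonal entry 1.
    have hsplit : ∀ j, (if i = i ∧ j = u then A i j + α else A i j) *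
        (if j ∈ D then (1 : Matrix V V ℂ) j c else if j = i then T j c - α * T u c else T j c) =
        A i j * T j c + ((if j = u then α * T u c else 0) - if j = i then α * T u c else 0) := by
      intro j
      by_cases hju : j = u
      · subst hju
        simp [huD, huy]
        ring
      by_cases hji : j = i
      · subst hji
        simp [hju, hyD, hyy]
        ring
      by_cases hjD : j ∈ D
      · simp [hju, hji, hyrow j hjD]
      · simp [hju, hji, hjD]
    rw [Finset.sum_congr rfl fun j _ => hsplit j, Finset.sum_add_distrib, hrowT,
      Finset.sum_sub_distrib]
    simp
  · rw [← hrowT]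
    refine Finset.sum_congr rfl fun j _ => ?_
    by_cases hj : j = y ∨ j ∈ D
    · simp [hiy, hrow i hiy hiD j hj]
    · push Not at hj
      simp [hiy, hj.1, hj.2]

end LinearAlgebra

/-! ### The single-door criterion. -/

section SingleDoor

open Matrix

theorem Matrix.mul_diagonal_mul_conjTranspose_apply {V : Type*} [Fintype V] [DecidableEq V]
    (T : Matrix V V ℂ) (δ : V → ℂ) (i c : V) :
    (T * diagonal δ * Tᴴ) i c = ∑ k, T i k * δ k * star (T c k) := by
  rw [Matrix.mul_apply]
  simp only [Matrix.mul_diagonal, conjTranspose_apply]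

/-- Under the single-door conditions, `u` is not a descendant of `y`. -/
theorem Digraph.DSep.not_isDescendant_of_deleteEdge {V : Type*} {G : Digraph V} {Z : Set V}
    {u y : V} (hsep : (G.deleteEdge u y).DSep {u} Z {y}) (hyZ : y ∉ Z)
    (hdes : ∀ z ∈ Z, ¬ G.IsDescendant y z) (hcyc : ¬ G.IsDescendant y y) :
    ¬ G.IsDescendant y u := by
  intro hyu
  -- The edge would close a cycle through `y`, so it is absent and deleting it changes nothing; the
  -- directed path from `y` to `u` is then an open path.
  have hadj : ¬ G.Adj u y := fun h => hcyc (hyu.tail h)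
  have hG : G.deleteEdge u y = G := by
    ext a b
    refine ⟨fun h => h.1, fun h => ⟨h, ?_⟩⟩
    rintro ⟨rfl, rfl⟩
    exact hadj h
  rw [hG] at hsep
  refine hsep.not_activeWalk hyZ false (Digraph.activeWalk_of_reflTransGen hyu.to_reflTransGen ?_)
  intro w hw hwZ
  rcases Relation.reflTransGen_iff_eq_or_transGen.1 hw with rfl | hw
  · exact hyZ hwZ
  · exact hdes w hwZ hw

theorem ldimGraph_eq_or_adj_of_ne_zero {V : Type*} [DecidableEq V] {H : ℤ → Matrix V V ℝ} {ω : ℝ}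
    {i j : V} (h : (1 - transferFn H ω) i j ≠ 0) :
    j = i ∨ (ldimGraph H).Adj j i := by
  by_contra! hcon
  refine h ?_
  have h0 : transferFn H ω i j = 0 := by
    by_contra hne
    exact hcon.2 ⟨ω, hne⟩
  rw [Matrix.sub_apply, h0, Matrix.one_apply_ne' hcon.1, sub_zero]

namespace IsLDIM

variable {V Θ : Type*} [MeasurableSpace Θ] {P : Measure Θ}
variable [Fintype V] [DecidableEq V] {H : ℤ → Matrix V V ℝ} {X E : V → ℤ → Lp ℝ 2 P}

/-- Under the single-door conditions, the cross spectra of `Y - α U` with `U` and `Z` are those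
of a combination of the processes in `Z` alone. -/
theorem exists_regression (hL : IsLDIM H X E) {U Y : V} {Z : Finset V} (hUY : U ≠ Y) (hUZ : U ∉ Z)
    (hYZ : Y ∉ Z) (hC1 : ∀ z ∈ Z, ¬ (ldimGraph H).IsDescendant Y z)
    (hC2 : ((ldimGraph H).deleteEdge U Y).DSep {U} (Z : Set V) {Y})
    (hC3 : ¬ (ldimGraph H).IsDescendant Y Y) (ω : ℝ) :
    ∃ β : V → ℂ, ∀ c ∈ insert U Z, psd X ω Y c =
      transferFn H ω Y U * psd X ω U c + ∑ z ∈ Z, β z * psd X ω z c := by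
  classical
  have hUD := hC2.not_isDescendant_of_deleteEdge (by simpa using hYZ) (by simpa using hC1) hC3
  have hnw := hC2.not_activeWalk (by simpa using hYZ)
  set G := ldimGraph H
  set G' := G.deleteEdge U Y with hG'
  set A := 1 - transferFn H ω with hA
  set α := transferFn H ω Y U with hα
  let D : Set V := {v | G.IsDescendant Y v}
  have hAT : A * A⁻¹ = 1 :=
    Matrix.mul_nonsing_inv _ ((Matrix.isUnit_iff_isUnit_det _).1 (hL.isUnit_one_sub ω))
  set T := A⁻¹ with hT
  set δ := (psd E ω).diag with hδ
  have hδpos : ∀ c, 0 < δ c := fun c => (hL.posDef_E ω).diag_pos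
  have hΦ : psd X ω = T * diagonal δ * Tᴴ := by
    rw [hδ, (hL.isDiag_E ω).diagonal_diag]
    exact hL.psd_eq ω
  have hA1 := Matrix.surgery_mul_inverse hAT D hUY hUD hC3
    (by rw [hA, Matrix.sub_apply, hL.diag_zero, Matrix.one_apply_eq, sub_zero])
    (fun j hj => by
      by_contra hne
      rcases ldimGraph_eq_or_adj_of_ne_zero hne with rfl | hadj
      · exact hC3 hj
      · exact hC3 (Relation.TransGen.tail hj hadj))
    (fun i hiY hiD j hj => by
      by_contra hne
      rcases ldimGraph_eq_or_adj_of_ne_zero hne with rfl | hadj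
      · exact hj.elim hiY hiD
      · rcases hj with rfl | hj
        · exact hiD (.single hadj)
        · exact hiD (Relation.TransGen.tail hj hadj)) α
  -- The rows in `D` are trivialized because children of `Y`, rewritten in terms of `Y - αU`, would
  -- acquire edges from `U`.
  set A₁ : Matrix V V ℂ := Matrix.of fun i j => if i ∈ D then (1 : Matrix V V ℂ) i j
        else if i = Y ∧ j = U then A i j + α else A i j with hA₁
  set T₁ : Matrix V V ℂ := Matrix.of fun i j => if i ∈ D then (1 : Matrix V V ℂ) i j
        else if i = Y then T i j - α * T U j else T i j with hT₁
  set Φ₁ := T₁ * diagonal δ * T₁ᴴ with hΦ₁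
  have hAdj₁ : ∀ c i, A₁ c i ≠ 0 → i = c ∨ G'.Adj i c := by
    intro c i hne
    rw [hA₁, Matrix.of_apply] at hne
    split_ifs at hne with h1 h2
    · left
      by_contra hic
      exact hne (Matrix.one_apply_ne' hic)
    · obtain ⟨rfl, rfl⟩ := h2
      exact absurd (by rw [hA, Matrix.sub_apply, Matrix.one_apply_ne hUY.symm]; ring) hne
    · exact (ldimGraph_eq_or_adj_of_ne_zero hne).imp_right fun h => ⟨h, fun h' => h2 ⟨h'.2, h'.1⟩⟩
  have hrow : ∀ i, i ≠ Y → i ∉ D → ∀ k, T₁ i k = T i k := by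
    intro i hi hiD k
    simp [hT₁, hi, hiD]
  have hrowY : ∀ k, T₁ Y k = T Y k - α * T U k := by
    intro k
    have : Y ∉ D := hC3
    simp [hT₁, this]
  have hCov : ∀ i, i ≠ Y → i ∉ D → ∀ c, c ≠ Y → c ∉ D → Φ₁ i c = psd X ω i c := by
    intro i hi hiD c hc hcD
    rw [hΦ, hΦ₁, mul_diagonal_mul_conjTranspose_apply, mul_diagonal_mul_conjTranspose_apply]
    simp only [hrow i hi hiD, hrow c hc hcD]
  have hCovY : ∀ c, c ≠ Y → c ∉ D → Φ₁ Y c = psd X ω Y c - α * psd X ω U c := by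
    intro c hc hcD
    rw [hΦ, hΦ₁, mul_diagonal_mul_conjTranspose_apply, mul_diagonal_mul_conjTranspose_apply,
      mul_diagonal_mul_conjTranspose_apply, Finset.mul_sum, ← Finset.sum_sub_distrib]
    refine Finset.sum_congr rfl fun k _ => ?_
    rw [hrow c hc hcD, hrowY]
    ring
  have hZY : ∀ z ∈ Z, z ≠ Y := fun z hz h => hYZ (h ▸ hz)
  -- regression coefficients of `Y - α U` onto `Z`
  let b : Z → ℂ := (fun c : Z => Φ₁ Y c) ᵥ* (psdOn X Z ω)⁻¹
  have hb : b ᵥ* psdOn X Z ω = fun c : Z => Φ₁ Y c := by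
    simp only [b]
    rw [vecMul_vecMul, Matrix.nonsing_inv_mul _
      ((Matrix.isUnit_iff_isUnit_det _).1 (hL.isUnit_psdOn Z ω)), vecMul_one]
  let β : V → ℂ := fun i => if h : i ∈ Z then b ⟨i, h⟩ else 0
  have hβ : ∀ i ∉ Z, β i = 0 := fun i hi => dif_neg hi
  let v : V → ℂ := Pi.single Y 1 - β
  have hx : ∀ c, c ≠ Y → c ∉ D → (v ᵥ* Φ₁) c =
      psd X ω Y c - α * psd X ω U c - ∑ z ∈ Z, β z * psd X ω z c := by
    intro c hc hcD
    simp only [v]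
    rw [sub_vecMul, single_one_vecMul, Pi.sub_apply, row_apply, hCovY c hc hcD]
    congr 1
    have h1 : (β ᵥ* Φ₁) c = ∑ z ∈ Z, β z * Φ₁ z c :=
      (Finset.sum_subset (Finset.subset_univ Z) fun i _ hi => by simp [hβ i hi]).symm
    rw [h1]
    exact Finset.sum_congr rfl fun z hz => by rw [hCov z (hZY z hz) (hC1 z hz) c hc hcD]
  have hxZ : ∀ z ∈ (Z : Set V), (v ᵥ* Φ₁) z = 0 := by
    intro c hc
    have hcZ : c ∈ Z := hc
    rw [hx c (hZY c hcZ) (hC1 c hcZ), ← hCovY c (hZY c hcZ) (hC1 c hcZ), sub_eq_zero]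
    rw [← congrFun hb ⟨c, hcZ⟩, ← Finset.sum_coe_sort Z]
    refine Finset.sum_congr rfl fun z _ => ?_
    simp [β, psdOn]
  -- Here `B` is the ancestral closure of `{U, Y} ∪ Z` in `G'` and `S` its part outside `Z` that
  -- active walks from `U` reach. Separation keeps `Y` out of `S`, so `v` vanishes on `S`.
  have hU := Matrix.vecMul_covariance_eq_zero_of_separated hA1 hδpos v
    {a | G'.IsAncestorOf (insert U (insert Y (Z : Set V))) a}
    {a | G'.IsAncestorOf (insert U (insert Y (Z : Set V))) a ∧ a ∉ Z ∧
      ∃ s, G'.ActiveWalk (Z : Set V) U a s} Z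
    (fun c hc i hi => by
      by_contra hne
      rcases hAdj₁ c i hne with rfl | hadj
      · exact hi hc
      · exact hi (Digraph.IsAncestorOf.of_adj hadj hc))
    (fun a ha => ha.1)
    (fun i hi => by
      have hiY : i ≠ Y := fun h => hi ⟨Y, by simp, h ▸ .refl⟩
      have hiZ : i ∉ Z := fun h => hi ⟨i, by simp [h], .refl⟩
      simp [v, hβ i hiZ, hiY])
    (fun i hi => by
      have hiY : i ≠ Y := by
        rintro rfl
        obtain ⟨s, hs⟩ := hi.2.2
        exact hnw s hs
      simp [v, hβ i hi.2.1, hiY])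
    hxZ
    (fun c hc i hi j hj hjZ hjS => by
      by_contra! hne
      exact hjS ⟨hj, hjZ, Digraph.activeWalk_transfer hnw hc (by simpa using hi.2.1)
        (hAdj₁ c i hne.1) (hAdj₁ c j hne.2) hi.2.2⟩)
    U ⟨⟨U, by simp, .refl⟩, hUZ, false, .refl⟩
  refine ⟨β, fun c hc => ?_⟩
  have hzero : (v ᵥ* Φ₁) c = 0 := by
    rcases Finset.mem_insert.1 hc with rfl | hc
    · exact hU
    · exact hxZ c hc
  have hcY : c ≠ Y ∧ c ∉ D := by
    rcases Finset.mem_insert.1 hc with rfl | hc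
    · exact ⟨hUY, hUD⟩
    · exact ⟨hZY c hc, hC1 c hc⟩
  rw [hx c hcY.1 hcY.2] at hzero
  linear_combination hzero

/-- The only solution of the normal equations has the coefficient `α` at `U`. -/
theorem apply_eq_of_vecMul_psdOn (hL : IsLDIM H X E) {U Y : V} {Z : Finset V} (hUY : U ≠ Y)
    (hUZ : U ∉ Z) (hYZ : Y ∉ Z) (hC1 : ∀ z ∈ Z, ¬ (ldimGraph H).IsDescendant Y z)
    (hC2 : ((ldimGraph H).deleteEdge U Y).DSep {U} (Z : Set V) {Y})
    (hC3 : ¬ (ldimGraph H).IsDescendant Y Y) (ω : ℝ) {w : ↥(insert U Z : Finset V) → ℂ}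
    (hw : w ᵥ* psdOn X (insert U Z) ω = fun c : ↥(insert U Z : Finset V) => psd X ω Y c) :
    w ⟨U, Finset.mem_insert_self U Z⟩ = transferFn H ω Y U := by
  obtain ⟨β, hβ⟩ := hL.exists_regression hUY hUZ hYZ hC1 hC2 hC3 ω
  let γ : V → ℂ := fun i => if i = U then transferFn H ω Y U else β i
  have hγ : (fun c : ↥(insert U Z : Finset V) => γ c) ᵥ* psdOn X (insert U Z) ω =
      fun c : ↥(insert U Z : Finset V) => psd X ω Y c := by
    funext c
    rw [hβ c c.2]
    have h1 : ((fun c : ↥(insert U Z : Finset V) => γ c) ᵥ* psdOn X (insert U Z) ω) c =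
        ∑ i ∈ insert U Z, γ i * psd X ω i c :=
      Finset.sum_coe_sort (insert U Z) fun i => γ i * psd X ω i c
    rw [h1, Finset.sum_insert hUZ]
    congr 1
    · simp [γ]
    · refine Finset.sum_congr rfl fun z hz => ?_
      have : z ≠ U := fun h => hUZ (h ▸ hz)
      simp [γ, this]
  have := Matrix.vecMul_injective_of_isUnit (hL.isUnit_psdOn (insert U Z) ω) (hw.trans hγ.symm)
  rw [this]
  simp [γ]

end IsLDIM

end SingleDoor

theorem mainTheorem3 {V Θ : Type*} [Fintype V] [DecidableEq V] [MeasurableSpace Θ]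
    (P : Measure Θ) [IsProbabilityMeasure P]
    (H : ℤ → Matrix V V ℝ) (X E : V → ℤ → Lp ℝ 2 P) (hL : IsLDIM H X E)
    (U Y : V) (Z : Finset V) (hUY : U ≠ Y) (hUZ : U ∉ Z) (hYZ : Y ∉ Z)
    (hC1 : ∀ z ∈ Z, ¬ (ldimGraph H).IsDescendant Y z)
    (hC2 : ((ldimGraph H).deleteEdge U Y).DSep {U} (Z : Set V) {Y})
    (hC3 : ¬ (ldimGraph H).IsDescendant Y Y) :
    (∀ ω : ℝ, IsUnit (psdOn X (insert U Z) ω) ∧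
      wienerFilter X Y (insert U Z) ω ⟨U, Finset.mem_insert_self U Z⟩ = transferFn H ω Y U) ∧
    (∀ w : ↥(insert U Z : Finset V) → ℤ → ℝ, RealizesProjection X Y (insert U Z) w →
      ∀ ω : ℝ, dtft (w ⟨U, Finset.mem_insert_self U Z⟩) ω = transferFn H ω Y U) := by
  refine ⟨fun ω => ?_, fun w hw ω => ?_⟩
  · have hu := hL.isUnit_psdOn (insert U Z) ω
    refine ⟨hu, hL.apply_eq_of_vecMul_psdOn hUY hUZ hYZ hC1 hC2 hC3 ω ?_⟩
    rw [wienerFilter, Matrix.vecMul_vecMul,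
      Matrix.nonsing_inv_mul _ ((Matrix.isUnit_iff_isUnit_det _).1 hu), Matrix.vecMul_one]
  · exact hL.apply_eq_of_vecMul_psdOn (w := fun c => dtft (w c) ω) hUY hUZ hYZ hC1 hC2 hC3 ω
      (hw.vecMul_psdOn hL.summable_X ω)
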